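/- Let $R$ be an associative ring with $1$. For $n\ge 1$, an $n$-place left pp formula is a formula $\phi(\bar x)=\exists\bar y\,(A\bar y=B\bar x)$, with $A\in R^{m\times k}$ and $B\in R^{m\times n}$; for a left $R$-module $M$, $\phi(M)\subseteq M^n$ denotes its solution set. Right pp formulas $\exists\bar y\,(\bar yC=\bar xD)$ and their solution sets in right modules are defined symmetrically. A formula is below another one (and the latter is above the former) if, in every module on the respective side, the solution set of the first is contained in that of the second. A divisibility formula is a left pp formula $A\mid\bar x$, i.e. $\exists\bar y\,(A\bar y=\bar x)$; an annihilation formula is a right pp formula $\bar xA=\bar 0$. A module is absolutely pure if it is pure in every module containing it, i.e. if every embedding of it into another module reflects solutions of pp formulas. Call $R$ right a-coherent if for every unary left pp formula $\phi$ the right ideal $I=\phi({}_RR)$ contains a finitely generated right ideal $I_0$ with the same left annihilator, $\{a\in R: aI=0\}=\{a\in R: aI_0=0\}$. The following are equivalent. 1. Every injective left $R$-module is flat ($R$ is left IF). 2. The injective envelope of every finitely presented left $R$-module is flat. 3. Every finitely presented left $R$-module embeds into a free left $R$-module. 4. The character module $\mathrm{Hom}_{\mathbb Z}(F,\mathbb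 Q/\mathbb Z)$ of every free right $R$-module $F$ is a flat left $R$-module. 5. For every $n\ge1$, every $n$-place left pp formula $\phi$ has the same solution set, in every absolutely pure left $R$-module, as some divisibility formula $A\mid\bar x$ below $\phi$ (one formula for all these modules). 6. For every $n\ge1$, every $n$-place right pp formula $\psi$ has the same solution set, in every flat right $R$-module, as some annihilation formula $\bar xA=\bar 0$ above $\psi$ (one formula for all these modules). 7. $R$ is absolutely pure as a right module over itself, and $R$ is right a-coherent. Moreover, it suffices to consider unary formulas: condition 5 restricted to $n=1$, and condition 6 restricted to $n=1$, are each equivalent to the conditions above. -/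

import Mathlib

/-!
Throughout, `R` is an associative ring with `1`, a left `R`-module is a `Module R M`, and a right
`R`-module is a `Module Rᵐᵒᵖ M`, where `a r` is written `MulOpposite.op r • a`.
-/

universe u

namespace IFRing

open scoped TensorProduct

/-! ### Positive primitive formulas -/

/-- An `n`-place pp formula `∃ y (A y = B x)` for left `R`-modules. -/
structure LeftPP (R : Type u) (n : ℕ) where
  k : ℕ
  m : ℕ
  A : Matrix (Fin m) (Fin k) R
  B : Matrix (Fin m) (Fin n) R

/-- An `n`-place pp formula `∃ y (y C = x D)` for right `R`-modules. -/
structure RightPP (R : Type u) (n : ℕ) where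
  k : ℕ
  m : ℕ
  C : Matrix (Fin k) (Fin m) R
  D : Matrix (Fin n) (Fin m) R

/-- The solution set `φ(M) ⊆ Mⁿ` of a left pp formula in a left module. -/
def LeftPP.sol {R : Type u} [Ring R] {n : ℕ} (φ : LeftPP R n)
    (M : Type u) [AddCommGroup M] [Module R M] : Set (Fin n → M) :=
  {x | ∃ y : Fin φ.k → M, ∀ i, ∑ j, φ.A i j • y j = ∑ j, φ.B i j • x j}

/-- The solution set `ψ(M) ⊆ Mⁿ` of a right pp formula in a right module. -/
def RightPP.sol {R : Type u} [Ring R] {n : ℕ} (ψ : RightPP R n)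
    (M : Type u) [AddCommGroup M] [Module Rᵐᵒᵖ M] : Set (Fin n → M) :=
  {x | ∃ y : Fin ψ.k → M, ∀ j,
    ∑ i, MulOpposite.op (ψ.C i j) • y i = ∑ i, MulOpposite.op (ψ.D i j) • x i}

/-- `φ ≤ φ'` in the lattice of left pp formulas: `φ(M) ⊆ φ'(M)` for every left module `M`. -/
def LeftPP.Below {R : Type u} [Ring R] {n : ℕ} (φ φ' : LeftPP R n) : Prop :=
  ∀ (M : Type u) [AddCommGroup M] [Module R M], φ.sol M ⊆ φ'.sol M

/-- `ψ ≤ ψ'` in the lattice of right pp formulas: `ψ(M) ⊆ ψ'(M)` for every right module `M`. -/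
def RightPP.Below {R : Type u} [Ring R] {n : ℕ} (ψ ψ' : RightPP R n) : Prop :=
  ∀ (M : Type u) [AddCommGroup M] [Module Rᵐᵒᵖ M], ψ.sol M ⊆ ψ'.sol M

/-- The divisibility formula `A | x`, that is, `∃ y (A y = x)`. -/
def LeftPP.divisibility {R : Type u} [Ring R] {n k : ℕ} (A : Matrix (Fin n) (Fin k) R) :
    LeftPP R n :=
  ⟨k, n, A, 1⟩

/-- The annihilation formula `x A = 0` for right modules (no bound variables). -/
def RightPP.annihilation {R : Type u} [Ring R] {n m : ℕ} (A : Matrix (Fin n) (Fin m) R) :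
    RightPP R n :=
  ⟨0, m, 0, A⟩

/-! ### Absolutely pure modules -/

/-- An embedding of left modules is pure if it reflects the solutions of all pp formulas. -/
def PureLeft {R : Type u} [Ring R] {M N : Type u} [AddCommGroup M] [Module R M]
    [AddCommGroup N] [Module R N] (f : M →ₗ[R] N) : Prop :=
  Function.Injective f ∧
    ∀ (n : ℕ) (φ : LeftPP R n) (x : Fin n → M), (fun i => f (x i)) ∈ φ.sol N → x ∈ φ.sol M

/-- An embedding of right modules is pure if it reflects the solutions of all pp formulas. -/
def PureRight {R : Type u} [Ring R] {M N : Type u} [AddCommGroup M] [Module Rᵐᵒᵖ M]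
    [AddCommGroup N] [Module Rᵐᵒᵖ N] (f : M →ₗ[Rᵐᵒᵖ] N) : Prop :=
  Function.Injective f ∧
    ∀ (n : ℕ) (ψ : RightPP R n) (x : Fin n → M), (fun i => f (x i)) ∈ ψ.sol N → x ∈ ψ.sol M

/-- A left module is absolutely pure if every embedding of it into a left module is pure. -/
def AbsPureLeft (R : Type u) [Ring R] (M : Type u) [AddCommGroup M] [Module R M] : Prop :=
  ∀ (N : Type u) [AddCommGroup N] [Module R N] (f : M →ₗ[R] N),
    Function.Injective f → PureLeft f

/-- A right module is absolutely pure if every embedding of it into a right module is pure. -/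
def AbsPureRight (R : Type u) [Ring R] (M : Type u) [AddCommGroup M] [Module Rᵐᵒᵖ M] : Prop :=
  ∀ (N : Type u) [AddCommGroup N] [Module Rᵐᵒᵖ N] (f : M →ₗ[Rᵐᵒᵖ] N),
    Function.Injective f → PureRight f

/-! ### Tensor products over a noncommutative ring and flat modules -/

/-- The subgroup of `A ⊗[ℤ] M` generated by the elements `a r ⊗ m - a ⊗ r m`. -/
def balancing (R : Type u) [Ring R] (A M : Type u) [AddCommGroup A] [Module Rᵐᵒᵖ A]
    [AddCommGroup M] [Module R M] : Submodule ℤ (A ⊗[ℤ] M) :=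
  Submodule.span ℤ
    {t | ∃ (a : A) (r : R) (m : M),
      t = (MulOpposite.op r • a) ⊗ₜ[ℤ] m - a ⊗ₜ[ℤ] (r • m)}

/-- The tensor product `A ⊗_R M` of a right module `A` and a left module `M`, an abelian group. -/
abbrev Tensor (R : Type u) [Ring R] (A M : Type u) [AddCommGroup A] [Module Rᵐᵒᵖ A]
    [AddCommGroup M] [Module R M] : Type u :=
  (A ⊗[ℤ] M) ⧸ balancing R A M

theorem balancing_le_comap {R : Type u} [Ring R] {A A' M M' : Type u}
    [AddCommGroup A] [Module Rᵐᵒᵖ A] [AddCommGroup A'] [Module Rᵐᵒᵖ A']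
    [AddCommGroup M] [Module R M] [AddCommGroup M'] [Module R M']
    (f : A →ₗ[Rᵐᵒᵖ] A') (g : M →ₗ[R] M') :
    balancing R A M ≤ (balancing R A' M').comap
      (TensorProduct.map f.toAddMonoidHom.toIntLinearMap g.toAddMonoidHom.toIntLinearMap) := by
  refine Submodule.span_le.2 ?_
  rintro _ ⟨a, r, m, rfl⟩
  refine Submodule.subset_span ⟨f a, r, g m, ?_⟩
  simp

/-- The homomorphism `f ⊗ g : A ⊗_R M → A' ⊗_R M'`. -/
def Tensor.map {R : Type u} [Ring R] {A A' M M' : Type u}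
    [AddCommGroup A] [Module Rᵐᵒᵖ A] [AddCommGroup A'] [Module Rᵐᵒᵖ A']
    [AddCommGroup M] [Module R M] [AddCommGroup M'] [Module R M']
    (f : A →ₗ[Rᵐᵒᵖ] A') (g : M →ₗ[R] M') : Tensor R A M →ₗ[ℤ] Tensor R A' M' :=
  Submodule.mapQ (balancing R A M) (balancing R A' M')
    (TensorProduct.map f.toAddMonoidHom.toIntLinearMap g.toAddMonoidHom.toIntLinearMap)
    (balancing_le_comap f g)

/-- A left module `M` is flat if `- ⊗_R M` preserves injectivity of maps of right modules. -/
def FlatLeft (R : Type u) [Ring R] (M : Type u) [AddCommGroup M] [Module R M] : Prop :=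
  ∀ (A B : Type u) [AddCommGroup A] [Module Rᵐᵒᵖ A] [AddCommGroup B] [Module Rᵐᵒᵖ B]
    (f : A →ₗ[Rᵐᵒᵖ] B), Function.Injective f →
      Function.Injective (Tensor.map f (LinearMap.id : M →ₗ[R] M))

/-- A right module `F` is flat if `F ⊗_R -` preserves injectivity of maps of left modules. -/
def FlatRight (R : Type u) [Ring R] (F : Type u) [AddCommGroup F] [Module Rᵐᵒᵖ F] : Prop :=
  ∀ (A B : Type u) [AddCommGroup A] [Module R A] [AddCommGroup B] [Module R B]
    (f : A →ₗ[R] B), Function.Injective f →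
      Function.Injective (Tensor.map (LinearMap.id : F →ₗ[Rᵐᵒᵖ] F) f)

/-! ### Injective envelopes, character modules, a-coherence -/

/-- `f : M → E` is an injective envelope: an essential embedding into an injective module. -/
structure IsInjectiveEnvelope {R : Type u} [Ring R] {M E : Type u} [AddCommGroup M] [Module R M]
    [AddCommGroup E] [Module R E] (f : M →ₗ[R] E) : Prop where
  injective_target : Module.Injective R E
  injective_map : Function.Injective f
  essential : ∀ N : Submodule R E, N ⊓ LinearMap.range f = ⊥ → N = ⊥

/-- The character module `F⁺ = Hom_ℤ(F, ℚ/ℤ)` of a right module `F` is a left module through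
`(r c)(x) = c (x r)`. -/
instance characterModuleOfRight {R : Type u} [Ring R] {F : Type u} [AddCommGroup F]
    [Module Rᵐᵒᵖ F] : Module R (CharacterModule F) where
  smul r c := AddMonoidHom.comp c (DistribSMul.toAddMonoidHom F (MulOpposite.op r))
  one_smul c := by
    refine CharacterModule.ext _ fun x => ?_
    change c (MulOpposite.op (1 : R) • x) = c x
    simp
  mul_smul r s c := by
    refine CharacterModule.ext _ fun x => ?_
    change c (MulOpposite.op (r * s) • x) = c (MulOpposite.op s • MulOpposite.op r • x)
    rw [MulOpposite.op_mul, mul_smul]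
  smul_zero r := rfl
  smul_add r c d := rfl
  add_smul r s c := by
    refine CharacterModule.ext _ fun x => ?_
    change c (MulOpposite.op (r + s) • x) = c (MulOpposite.op r • x) + c (MulOpposite.op s • x)
    rw [MulOpposite.op_add, add_smul, map_add]
  zero_smul c := by
    refine CharacterModule.ext _ fun x => ?_
    change c (MulOpposite.op (0 : R) • x) = 0
    simp

/-- `R` is right a-coherent: for every unary left pp formula `φ`, the right ideal `φ(R)` contains a
finitely generated right ideal `I₀` with the same left annihilator. -/
def RightACoherent (R : Type u) [Ring R] : Prop :=
  ∀ φ : LeftPP R 1, ∃ I₀ : Submodule Rᵐᵒᵖ R, I₀.FG ∧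
    (∀ b ∈ I₀, (fun _ => b) ∈ φ.sol R) ∧
    {a : R | ∀ b : R, (fun _ => b) ∈ φ.sol R → a * b = 0} = {a : R | ∀ b ∈ I₀, a * b = 0}

/-! ### The pp conditions in a fixed arity -/

/-- Every `n`-place left pp formula `φ` is equivalent, in all absolutely pure left modules, to a
divisibility formula below `φ`. -/
def DivisibilityCondition (R : Type u) [Ring R] (n : ℕ) : Prop :=
  ∀ φ : LeftPP R n, ∃ (k : ℕ) (A : Matrix (Fin n) (Fin k) R),
    (LeftPP.divisibility A).Below φ ∧
    ∀ (M : Type u) [AddCommGroup M] [Module R M], AbsPureLeft R M →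
      φ.sol M = (LeftPP.divisibility A).sol M

/-- Every `n`-place right pp formula `ψ` is equivalent, in all flat right modules, to an
annihilation formula above `ψ`. -/
def AnnihilationCondition (R : Type u) [Ring R] (n : ℕ) : Prop :=
  ∀ ψ : RightPP R n, ∃ (m : ℕ) (A : Matrix (Fin n) (Fin m) R),
    ψ.Below (RightPP.annihilation A) ∧
    ∀ (F : Type u) [AddCommGroup F] [Module Rᵐᵒᵖ F], FlatRight R F →
      ψ.sol F = (RightPP.annihilation A).sol F

end IFRing

/-!
Every pp formula `φ` has an elementary dual `Dφ` on the other side, and `∑ i, w i • x i = 0` for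
`w ∈ Dφ(R)` and `x ∈ φ(M)`. On an absolutely pure module this orthogonality characterizes `φ(M)`,
whereas a module is flat exactly when `φ(M) = φ(R) M` for all `φ`; character modules exchange the
flat and the injective modules of the two sides. Hence all the conditions say that `Dφ(R)` is cut
out by finitely many elements of `φ(R)`: these are the columns of the matrix `A` in the
divisibility formula `A ∣ x` and in the annihilation formula `x A = 0`, and generators of `I₀` in
the unary case. The property passes from unary formulas to all arities: if `(w₀, w₁)` annihilates
enough elements of `φ(R)`, the test set for `φ(x₀, 0)` gives some `(w₀, v)` in `Dφ(R)`, and the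
test set for `∃ x₀ φ(x₀, x)` shows that the difference `(0, w₁ - v)` lies there too.
-/

namespace IFRing

open Matrix MulOpposite
open scoped TensorProduct

variable {R : Type u} [Ring R] {A A' M M' : Type u}
  [AddCommGroup A] [Module Rᵐᵒᵖ A] [AddCommGroup A'] [Module Rᵐᵒᵖ A']
  [AddCommGroup M'] [Module R M'] [AddCommGroup M] [Module R M]

/-! ### Character modules -/

/-- The character module `M⁺ = Hom_ℤ(M, ℚ/ℤ)` of a left module `M` is a right module through
`(c r)(x) = c (r x)`. -/
instance characterModuleOfLeft : Module Rᵐᵒᵖ (CharacterModule M) where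
  smul r c := AddMonoidHom.comp c (DistribSMul.toAddMonoidHom M r.unop)
  one_smul c := CharacterModule.ext _ fun x => congrArg c (one_smul R x)
  mul_smul r s c := CharacterModule.ext _ fun x => congrArg c (mul_smul s.unop r.unop x)
  smul_zero _ := rfl
  smul_add _ _ _ := rfl
  add_smul r s c := CharacterModule.ext _ fun x =>
    (congrArg c (add_smul r.unop s.unop x)).trans (map_add c _ _)
  zero_smul c := CharacterModule.ext _ fun x => (congrArg c (zero_smul R x)).trans (map_zero c)

theorem op_smul_characterModule_apply (r : R) (c : CharacterModule M) (x : M) :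
    (op r • c) x = c (r • x) := rfl

theorem sum_characterModule_apply {X ι : Type*} [AddCommGroup X] (s : Finset ι)
    (χ : ι → CharacterModule X) (x : X) : (∑ i ∈ s, χ i) x = ∑ i ∈ s, χ i x :=
  AddMonoidHom.finsetSum_apply χ s x

/-- Both `Hom(A, M⁺)` and `Hom(M, A⁺)` consist of the balanced pairings `A × M → ℚ/ℤ`. -/
def characterHomFlip : (A →ₗ[Rᵐᵒᵖ] CharacterModule M) ≃ (M →ₗ[R] CharacterModule A) where
  toFun g :=
    { toFun x := AddMonoidHom.flip g.toAddMonoidHom x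
      map_add' := map_add (AddMonoidHom.flip g.toAddMonoidHom)
      map_smul' r x := CharacterModule.ext _ fun a => congr($(g.map_smul (op r) a) x).symm }
  invFun g :=
    { toFun a := AddMonoidHom.flip g.toAddMonoidHom a
      map_add' := map_add (AddMonoidHom.flip g.toAddMonoidHom)
      map_smul' r a := CharacterModule.ext _ fun x => congr($(g.map_smul r.unop x) a).symm }
  left_inv _ := rfl
  right_inv _ := rfl

/-- Precomposition with a map of left modules, as a map of right modules `M'⁺ → M⁺`. -/
def dualOfLeft (f : M →ₗ[R] M') : CharacterModule M' →ₗ[Rᵐᵒᵖ] CharacterModule M :=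
  characterHomFlip.symm (characterHomFlip LinearMap.id ∘ₗ f)

/-- Precomposition with a map of right modules, as a map of left modules `A'⁺ → A⁺`. -/
def dualOfRight (f : A →ₗ[Rᵐᵒᵖ] A') : CharacterModule A' →ₗ[R] CharacterModule A :=
  characterHomFlip (characterHomFlip.symm LinearMap.id ∘ₗ f)

theorem dualOfLeft_surjective {f : M →ₗ[R] M'} (hf : Function.Injective f) :
    Function.Surjective (dualOfLeft f) :=
  CharacterModule.dual_surjective_of_injective f.toAddMonoidHom.toIntLinearMap hf

theorem dualOfRight_surjective {f : A →ₗ[Rᵐᵒᵖ] A'} (hf : Function.Injective f) :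
    Function.Surjective (dualOfRight f) :=
  CharacterModule.dual_surjective_of_injective f.toAddMonoidHom.toIntLinearMap hf

theorem injective_characterModule_of_right (A : Type u) [AddCommGroup A] [Module Rᵐᵒᵖ A]
    [Module.Projective Rᵐᵒᵖ A] : Module.Injective R (CharacterModule A) where
  out X Y _ _ _ _ f hf g := by
    obtain ⟨h, hh⟩ := Module.projective_lifting_property (dualOfLeft f) (characterHomFlip.symm g)
      (dualOfLeft_surjective hf)
    exact ⟨characterHomFlip h, fun x => CharacterModule.ext _ fun a => congr($hh a x)⟩

theorem injective_characterModule_of_left (M : Type u) [AddCommGroup M] [Module R M]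
    [Module.Projective R M] : Module.Injective Rᵐᵒᵖ (CharacterModule M) where
  out X Y _ _ _ _ f hf g := by
    obtain ⟨h, hh⟩ := Module.projective_lifting_property (dualOfRight f) (characterHomFlip g)
      (dualOfRight_surjective hf)
    exact ⟨characterHomFlip.symm h, fun a => CharacterModule.ext _ fun x => congr($hh x a)⟩

variable (R M) in
theorem exists_embedding_characterModule_of_free :
    ∃ (F : Type u) (_ : AddCommGroup F) (_ : Module Rᵐᵒᵖ F) (_ : Module.Free Rᵐᵒᵖ F)
      (f : M →ₗ[R] CharacterModule F), Function.Injective f := by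
  let π := Finsupp.linearCombination Rᵐᵒᵖ (id : CharacterModule M → CharacterModule M)
  refine ⟨_, _, _, inferInstance, characterHomFlip π,
    (injective_iff_map_eq_zero _).2 fun x hx => ?_⟩
  refine CharacterModule.eq_zero_of_character_apply fun c => ?_
  obtain ⟨a, rfl⟩ := Finsupp.linearCombination_id_surjective Rᵐᵒᵖ (CharacterModule M) c
  exact congr($hx a)

/-! ### Tensor products and flatness -/

/-- The homomorphism `X ⊗[ℤ] Y → G` corresponding to a biadditive map. -/
def biadditiveLift {X Y G : Type*} [AddCommGroup X] [AddCommGroup Y] [AddCommGroup G]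
    (b : X →+ Y →+ G) : X ⊗[ℤ] Y →ₗ[ℤ] G :=
  (TensorProduct.liftAddHom b fun n x y =>
    congr($(map_zsmul b n x) y).trans (map_zsmul (b x) n y).symm).toIntLinearMap

/-- The elementary tensor `a ⊗ x` in `A ⊗_R M`. -/
def tmul (R : Type u) [Ring R] {A M : Type u} [AddCommGroup A] [Module Rᵐᵒᵖ A]
    [AddCommGroup M] [Module R M] (a : A) (x : M) : Tensor R A M :=
  (balancing R A M).mkQ (a ⊗ₜ[ℤ] x)

theorem op_smul_tmul (r : R) (a : A) (x : M) : tmul R (op r • a) x = tmul R a (r • x) :=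
  (Submodule.Quotient.eq _).2 (Submodule.subset_span ⟨a, r, x, rfl⟩)

theorem Tensor.character_ext {c d : CharacterModule (Tensor R A M)}
    (h : ∀ a x, c (tmul R a x) = d (tmul R a x)) : c = d := by
  refine CharacterModule.ext _ fun t => ?_
  obtain ⟨t, rfl⟩ := Submodule.mkQ_surjective _ t
  induction t using TensorProduct.induction_on with
  | zero => simp only [map_zero]
  | tmul a x => exact h a x
  | add s t hs ht => simp only [map_add, hs, ht]

/-- Characters of `A ⊗_R M` are balanced pairings `A × M → ℚ/ℤ`. -/
def tensorCharacterEquiv : CharacterModule (Tensor R A M) ≃ (A →ₗ[Rᵐᵒᵖ] CharacterModule M) where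
  toFun c :=
    { toFun a := AddMonoidHom.comp c
        ((balancing R A M).mkQ ∘ₗ TensorProduct.mk ℤ A M a).toAddMonoidHom
      map_add' a a' := CharacterModule.ext _ fun x =>
        (congrArg (c ∘ (balancing R A M).mkQ) (TensorProduct.add_tmul a a' x)).trans
          (by simp only [Function.comp_apply, map_add]; rfl)
      map_smul' r a := CharacterModule.ext _ fun x => congrArg c (op_smul_tmul r.unop a x) }
  invFun g := ((balancing R A M).liftQ (biadditiveLift g.toAddMonoidHom) <|
    Submodule.span_le.2 <| by
      rintro _ ⟨a, r, x, rfl⟩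
      exact (map_sub _ _ _).trans (sub_eq_zero.2 congr($(g.map_smul (op r) a) x))).toAddMonoidHom
  left_inv c := Tensor.character_ext fun a x => rfl
  right_inv g := rfl

theorem Tensor.injective_map_left_iff (f : A →ₗ[Rᵐᵒᵖ] A') :
    Function.Injective (Tensor.map f (LinearMap.id : M →ₗ[R] M)) ↔
      ∀ g : A →ₗ[Rᵐᵒᵖ] CharacterModule M, ∃ h : A' →ₗ[Rᵐᵒᵖ] CharacterModule M,
        ∀ a, h (f a) = g a := by
  rw [← CharacterModule.dual_surjective_iff_injective]
  refine tensorCharacterEquiv.forall_congr fun {c} =>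
    tensorCharacterEquiv.exists_congr fun {d} => ?_
  rw [← tensorCharacterEquiv.injective.eq_iff]
  exact LinearMap.ext_iff

theorem Tensor.injective_map_right_iff (f : M →ₗ[R] M') :
    Function.Injective (Tensor.map (LinearMap.id : A →ₗ[Rᵐᵒᵖ] A) f) ↔
      ∀ g : M →ₗ[R] CharacterModule A, ∃ h : M' →ₗ[R] CharacterModule A,
        ∀ x, h (f x) = g x := by
  rw [← CharacterModule.dual_surjective_iff_injective]
  refine (tensorCharacterEquiv.trans characterHomFlip).forall_congr fun {c} =>
    (tensorCharacterEquiv.trans characterHomFlip).exists_congr fun {d} => ?_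
  rw [← (tensorCharacterEquiv.trans characterHomFlip).injective.eq_iff]
  exact LinearMap.ext_iff

theorem flatLeft_iff_injective_characterModule :
    FlatLeft R M ↔ Module.Injective Rᵐᵒᵖ (CharacterModule M) :=
  ⟨fun h => ⟨fun _ _ _ _ _ _ f hf => (Tensor.injective_map_left_iff f).1 (h _ _ f hf)⟩,
    fun h _ _ _ _ _ _ f hf => (Tensor.injective_map_left_iff f).2 (h.out f hf)⟩

theorem flatRight_iff_injective_characterModule :
    FlatRight R A ↔ Module.Injective R (CharacterModule A) :=
  ⟨fun h => ⟨fun _ _ _ _ _ _ f hf => (Tensor.injective_map_right_iff f).1 (h _ _ f hf)⟩,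
    fun h _ _ _ _ _ _ f hf => (Tensor.injective_map_right_iff f).2 (h.out f hf)⟩

theorem flatLeft_of_projective [Module.Projective R M] : FlatLeft R M :=
  flatLeft_iff_injective_characterModule.2 (injective_characterModule_of_left M)

variable (R) in
theorem flatRight_self : FlatRight R R :=
  have : Module.Projective Rᵐᵒᵖ R := .of_equiv
    { opAddEquiv.symm with map_smul' := fun _ _ => rfl : Rᵐᵒᵖ ≃ₗ[Rᵐᵒᵖ] R }
  flatRight_iff_injective_characterModule.2 (injective_characterModule_of_right R)

/-! ### Duality of pp formulas -/

/-- Prest's elementary dual of `∃ y (A y = B x)`, namely `∃ z (z A = 0 ∧ z B = w)`; the two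
conjuncts form one system with coefficients `z (A | B) = w (0 | 1)`. -/
def LeftPP.dual {n : ℕ} (φ : LeftPP R n) : RightPP R n where
  k := φ.m
  m := φ.k + n
  C := .of fun i => Fin.append (φ.A i) (φ.B i)
  D := .of fun i => Fin.append 0 (Pi.single i 1)

/-- Prest's elementary dual of `∃ y (y C = w D)`, namely `∃ v (C v = 0 ∧ D v = x)`. -/
def RightPP.dual {n : ℕ} (ψ : RightPP R n) : LeftPP R n where
  k := ψ.m
  m := ψ.k + n
  A := .of fun i j => Fin.append (ψ.C · j) (ψ.D · j) i
  B := .of fun i j => Fin.append 0 (Pi.single j 1) i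

variable {n : ℕ} {φ : LeftPP R n} {ψ : RightPP R n}

theorem LeftPP.mem_dual_sol {w : Fin n → A} : w ∈ φ.dual.sol A ↔ ∃ z : Fin φ.m → A,
    (∀ j, ∑ i, op (φ.A i j) • z i = 0) ∧ ∀ j, ∑ i, op (φ.B i j) • z i = w j := by
  simp only [LeftPP.dual, RightPP.sol, Set.mem_ofPred_eq, Fin.forall_fin_add, of_apply,
    Fin.append_left, Fin.append_right, Pi.zero_apply, op_zero, zero_smul, Finset.sum_const_zero,
    Pi.single_apply, apply_ite op, op_one, ite_smul, one_smul, Finset.sum_ite_eq, Finset.mem_univ,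
    if_true]
  rfl

theorem RightPP.mem_dual_sol {x : Fin n → M} : x ∈ ψ.dual.sol M ↔ ∃ v : Fin ψ.m → M,
    (∀ i, ∑ j, ψ.C i j • v j = 0) ∧ ∀ i, ∑ j, ψ.D i j • v j = x i := by
  simp only [RightPP.dual, LeftPP.sol, Set.mem_ofPred_eq, Fin.forall_fin_add, of_apply,
    Fin.append_left, Fin.append_right, Pi.zero_apply, zero_smul, Finset.sum_const_zero,
    Pi.single_apply, ite_smul, one_smul, Finset.sum_ite_eq, Finset.mem_univ, if_true]
  rfl

theorem LeftPP.dual_dual_sol : φ.dual.dual.sol M = φ.sol M := by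
  have sum_C (i : Fin φ.m) (v : Fin (φ.k + n) → M) : ∑ j, φ.dual.C i j • v j =
      ∑ j, φ.A i j • v (.castAdd n j) + ∑ j, φ.B i j • v (.natAdd φ.k j) :=
    (Fin.sum_univ_add _).trans (by
      simp only [LeftPP.dual, of_apply, Fin.append_left, Fin.append_right])
  have sum_D (i) (v : Fin (φ.k + n) → M) : ∑ j, φ.dual.D i j • v j = v (.natAdd φ.k i) :=
    (Fin.sum_univ_add _).trans (by
      simp [LeftPP.dual, Pi.single_apply])
  ext x
  rw [RightPP.mem_dual_sol]
  constructor
  · rintro ⟨v, hv, hx⟩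
    refine ⟨fun j => -v (Fin.castAdd n j), fun i => ?_⟩
    obtain rfl := funext fun i => (sum_D i v).symm.trans (hx i)
    simpa only [smul_neg, Finset.sum_neg_distrib, neg_eq_iff_add_eq_zero] using
      (sum_C i v).symm.trans (hv i)
  · rintro ⟨y, hy⟩
    refine ⟨Fin.append (-y) x, fun (i : Fin φ.m) => (sum_C i _).trans ?_,
      fun i => (sum_D i _).trans ?_⟩
    · simp only [Fin.append_left, Fin.append_right, Pi.neg_apply, smul_neg,
        Finset.sum_neg_distrib, hy, neg_add_cancel]
    · exact Fin.append_right _ _ i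

theorem RightPP.dual_dual_sol : ψ.dual.dual.sol A = ψ.sol A := by
  have sum_A (j : Fin ψ.m) (z : Fin (ψ.k + n) → A) : ∑ i, op (ψ.dual.A i j) • z i =
      ∑ i, op (ψ.C i j) • z (.castAdd n i) + ∑ i, op (ψ.D i j) • z (.natAdd ψ.k i) :=
    (Fin.sum_univ_add _).trans (by
      simp only [RightPP.dual, of_apply, Fin.append_left, Fin.append_right])
  have sum_B (j) (z : Fin (ψ.k + n) → A) : ∑ i, op (ψ.dual.B i j) • z i = z (.natAdd ψ.k j) :=
    (Fin.sum_univ_add _).trans (by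
      simp [RightPP.dual, Pi.single_apply, apply_ite op])
  ext w
  rw [LeftPP.mem_dual_sol]
  constructor
  · rintro ⟨z, hz, hw⟩
    refine ⟨fun i => -z (Fin.castAdd n i), fun j => ?_⟩
    obtain rfl := funext fun j => (sum_B j z).symm.trans (hw j)
    simpa only [smul_neg, Finset.sum_neg_distrib, neg_eq_iff_add_eq_zero] using
      (sum_A j z).symm.trans (hz j)
  · rintro ⟨y, hy⟩
    refine ⟨Fin.append (-y) w, fun (j : Fin ψ.m) => (sum_A j _).trans ?_,
      fun j => (sum_B j _).trans ?_⟩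
    · simp only [Fin.append_left, Fin.append_right, Pi.neg_apply, smul_neg,
        Finset.sum_neg_distrib, hy, neg_add_cancel]
    · exact Fin.append_right _ _ j

section Pairing

variable {G : Type*} [AddCommGroup G] {b : A →+ M →+ G}

theorem sum_pairing_op_smul {ι κ : Type*} [Fintype ι] [Fintype κ]
    (hb : ∀ (a : A) (r : R) (x : M), b (op r • a) x = b a (r • x)) (T : Matrix ι κ R)
    (z : ι → A) (x : κ → M) :
    ∑ j, b (∑ i, op (T i j) • z i) (x j) = ∑ i, b (z i) (∑ j, T i j • x j) := by
  simp only [map_sum, AddMonoidHom.finsetSum_apply, hb]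
  exact Finset.sum_comm

theorem LeftPP.sum_pairing_eq_zero (hb : ∀ (a : A) (r : R) (x : M), b (op r • a) x = b a (r • x))
    {w : Fin n → A} {x : Fin n → M} (hw : w ∈ φ.dual.sol A) (hx : x ∈ φ.sol M) :
    ∑ i, b (w i) (x i) = 0 := by
  obtain ⟨z, hzA, hzB⟩ := LeftPP.mem_dual_sol.1 hw
  obtain ⟨y, hy⟩ := hx
  calc ∑ i, b (w i) (x i) = ∑ i, b (z i) (∑ j, φ.B i j • x j) := by
        simp only [← sum_pairing_op_smul hb, hzB]
    _ = ∑ i, b (z i) (∑ j, φ.A i j • y j) := by simp only [hy]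
    _ = 0 := by simp only [← sum_pairing_op_smul hb, hzA, map_zero, AddMonoidHom.zero_apply,
        Finset.sum_const_zero]

theorem RightPP.sum_pairing_eq_zero (hb : ∀ (a : A) (r : R) (x : M), b (op r • a) x = b a (r • x))
    {w : Fin n → A} {x : Fin n → M} (hw : w ∈ ψ.sol A) (hx : x ∈ ψ.dual.sol M) :
    ∑ i, b (w i) (x i) = 0 :=
  LeftPP.sum_pairing_eq_zero hb (by rwa [RightPP.dual_dual_sol]) hx

end Pairing

theorem LeftPP.sum_smul_eq_zero {w : Fin n → R} {x : Fin n → M} (hw : w ∈ φ.dual.sol R)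
    (hx : x ∈ φ.sol M) : ∑ i, w i • x i = 0 :=
  LeftPP.sum_pairing_eq_zero (φ := φ) (b := smulAddHom R M) (fun a r x => mul_smul (β := M) a r x)
    hw hx

theorem RightPP.sum_op_smul_eq_zero {w : Fin n → A} {x : Fin n → R} (hw : w ∈ ψ.sol A)
    (hx : x ∈ ψ.dual.sol R) : ∑ i, op (x i) • w i = 0 :=
  RightPP.sum_pairing_eq_zero
    (b := ((smulAddHom Rᵐᵒᵖ A).comp (opAddEquiv : R ≃+ Rᵐᵒᵖ).toAddMonoidHom).flip)
    (fun a r x => (mul_smul (op x) (op r) a).symm) hw hx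

theorem exists_characters_separating {X ι : Type*} [AddCommGroup X] [Fintype ι]
    {S : AddSubgroup (ι → X)} {x : ι → X} (hx : x ∉ S) : ∃ χ : ι → CharacterModule X,
      (∀ s ∈ S, ∑ i, χ i (s i) = 0) ∧ ∑ i, χ i (x i) ≠ 0 := by
  classical
  obtain ⟨c, hc⟩ := CharacterModule.exists_character_apply_ne_zero_of_ne_zero
    (mt (QuotientAddGroup.eq_zero_iff x).1 hx)
  let χ : ι → CharacterModule X :=
    fun i => AddMonoidHom.comp c
      ((QuotientAddGroup.mk' S).comp (AddMonoidHom.single (fun _ => X) i))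
  have hχ (s : ι → X) : ∑ i, χ i (s i) = c s := by
    conv_rhs => rw [← Finset.univ_sum_single s]
    exact (map_sum (AddMonoidHom.comp c (QuotientAddGroup.mk' S)) _ _).symm
  refine ⟨χ, fun s hs => ?_, by rwa [hχ]⟩
  rw [hχ, (QuotientAddGroup.eq_zero_iff s).2 hs, map_zero]

theorem exists_solution_of_characters {X ι κ : Type*} [AddCommGroup X] [Fintype ι] [Fintype κ]
    (T : ι → κ → X →+ X) (t : ι → X)
    (h : ∀ χ : ι → CharacterModule X,
      (∀ j x, ∑ i, χ i (T i j x) = 0) → ∑ i, χ i (t i) = 0) :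
    ∃ y : κ → X, ∀ i, ∑ j, T i j (y j) = t i := by
  classical
  let evalT : (κ → X) →+ ι → X :=
    ∑ j, (AddMonoidHom.pi fun i => T i j).comp (Pi.evalAddMonoidHom (fun _ => X) j)
  have evalT_apply (y : κ → X) : evalT y = fun i => ∑ j, T i j (y j) := by
    ext i
    simp [evalT]
  by_contra! hT
  have ht : t ∉ evalT.range := by
    rintro ⟨y, hy⟩
    obtain ⟨i, hi⟩ := hT y
    exact hi (congrFun ((evalT_apply y).symm.trans hy) i)
  obtain ⟨χ, hχT, hχt⟩ := exists_characters_separating ht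
  refine hχt (h χ fun j x => ?_)
  have := hχT _ ⟨Pi.single j x, rfl⟩
  simpa [evalT_apply, Pi.single_apply, apply_ite] using this

theorem LeftPP.mem_sol_iff_characters {x : Fin n → M} : x ∈ φ.sol M ↔
    ∀ χ ∈ φ.dual.sol (CharacterModule M), ∑ i, χ i (x i) = 0 := by
  have balanced (c : CharacterModule M) (r : R) (x : M) : (op r • c) x = c (r • x) := rfl
  let b : CharacterModule M →+ M →+ AddCircle (1 : ℚ) := AddMonoidHom.id _
  refine ⟨fun hx χ hχ => LeftPP.sum_pairing_eq_zero (b := b) balanced hχ hx, fun h => ?_⟩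
  refine exists_solution_of_characters (fun i j => DistribSMul.toAddMonoidHom M (φ.A i j))
    (fun i => ∑ j, φ.B i j • x j) fun c hc => ?_
  refine (sum_pairing_op_smul (b := b) balanced φ.B c x).symm.trans
    (h _ (LeftPP.mem_dual_sol.2 ⟨c, fun j => CharacterModule.ext _ fun x => ?_, fun _ => rfl⟩))
  exact (sum_characterModule_apply _ _ _).trans (hc j x)

theorem RightPP.mem_sol_iff_characters {w : Fin n → A} : w ∈ ψ.sol A ↔
    ∀ χ ∈ ψ.dual.sol (CharacterModule A), ∑ i, χ i (w i) = 0 := by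
  have balanced (a : A) (r : R) (c : CharacterModule A) : c (op r • a) = (r • c) a := rfl
  let b : A →+ CharacterModule A →+ AddCircle (1 : ℚ) := AddMonoidHom.flip (AddMonoidHom.id _)
  refine ⟨fun hw χ hχ => RightPP.sum_pairing_eq_zero (b := b) balanced hw hχ, fun h => ?_⟩
  refine exists_solution_of_characters (fun j i => DistribSMul.toAddMonoidHom A (op (ψ.C i j)))
    (fun j => ∑ i, op (ψ.D i j) • w i) fun c hc => ?_
  refine (sum_pairing_op_smul (b := b) balanced ψ.D w c).trans
    (h _ (RightPP.mem_dual_sol.2 ⟨c, fun i => CharacterModule.ext _ fun a => ?_, fun _ => rfl⟩))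
  exact (sum_characterModule_apply _ _ _).trans (hc i a)

theorem exists_comp_eq_of_ker_le {S X Y Q : Type*} [Ring S] [AddCommGroup X] [Module S X]
    [AddCommGroup Y] [Module S Y] [AddCommGroup Q] [Module S Q] (hQ : Module.Baer S Q)
    (c : X →ₗ[S] Y) (χ : X →ₗ[S] Q) (h : LinearMap.ker c ≤ LinearMap.ker χ) :
    ∃ g : Y →ₗ[S] Q, g ∘ₗ c = χ := by
  obtain ⟨g, hg⟩ := hQ.extension_property ((LinearMap.ker c).liftQ c le_rfl)
    (LinearMap.ker_eq_bot.1 (Submodule.ker_liftQ_eq_bot' _ c rfl)) ((LinearMap.ker c).liftQ χ h)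
  exact ⟨g, LinearMap.ext fun x => congr($hg (Submodule.Quotient.mk x))⟩

theorem exists_solution_of_baer {S E ι κ : Type*} [Ring S] [AddCommGroup E] [Module S E]
    [Fintype ι] [Fintype κ] (hE : Module.Baer S E) (T : Matrix ι κ S) (t : ι → E)
    (h : ∀ z, z ᵥ* T = 0 → ∑ i, z i • t i = 0) :
    ∃ y : κ → E, ∀ i, ∑ j, T i j • y j = t i := by
  classical
  obtain ⟨g, hg⟩ := exists_comp_eq_of_ker_le hE T.vecMulLinear (Fintype.linearCombination S t)
    fun z hz => h z hz
  refine ⟨fun j => g (Pi.single j 1), fun i => ?_⟩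
  have hgi : g (T i) = t i := by
    simpa only [LinearMap.comp_apply, vecMulLinear_apply, single_one_vecMul, Matrix.row,
      Fintype.linearCombination_apply_single, one_smul] using congr($hg (Pi.single i 1))
  simp_rw [← hgi, ← map_smul, ← map_sum, ← pi_eq_sum_univ']

theorem LeftPP.mem_sol_of_injective [Module.Injective R M] {x : Fin n → M}
    (hx : ∀ w ∈ φ.dual.sol R, ∑ i, w i • x i = 0) : x ∈ φ.sol M := by
  refine exists_solution_of_baer (.of_injective ‹_›) φ.A (fun i => ∑ j, φ.B i j • x j)
    fun z hz => ?_
  have hzB : z ᵥ* φ.B ∈ φ.dual.sol R :=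
    LeftPP.mem_dual_sol.2 ⟨z, congrFun hz, fun _ => rfl⟩
  rw [← hx _ hzB]
  simp only [vecMul, dotProduct, Finset.smul_sum, Finset.sum_smul, smul_smul]
  exact Finset.sum_comm

theorem RightPP.mem_sol_of_injective [Module.Injective Rᵐᵒᵖ A] {w : Fin n → A}
    (hw : ∀ x ∈ ψ.dual.sol R, ∑ i, op (x i) • w i = 0) : w ∈ ψ.sol A := by
  refine exists_solution_of_baer (.of_injective ‹_›) (.of fun j i => op (ψ.C i j))
    (fun j => ∑ i, op (ψ.D i j) • w i) fun z hz => ?_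
  have hDz : ψ.D *ᵥ (unop ∘ z) ∈ ψ.dual.sol R :=
    RightPP.mem_dual_sol.2 ⟨unop ∘ z, fun i => ?_, fun _ => rfl⟩
  · rw [← hw _ hDz]
    simp only [mulVec, dotProduct, Function.comp_apply, Finset.op_sum, op_mul, op_unop,
      Finset.smul_sum, Finset.sum_smul, smul_smul]
    exact Finset.sum_comm
  · refine op_injective ?_
    simpa only [Finset.op_sum, op_mul, op_unop, op_zero, Function.comp_apply] using!
      congrFun hz i

theorem exists_embedding_injective (S M : Type u) [Ring S] [AddCommGroup M] [Module S M] :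
    ∃ (E : Type u) (_ : AddCommGroup E) (_ : Module S E) (f : M →ₗ[S] E),
      Module.Injective S E ∧ Function.Injective f :=
  ⟨(CategoryTheory.Injective.under (ModuleCat.of S M) : ModuleCat S), inferInstance, inferInstance,
    (CategoryTheory.Injective.ι (ModuleCat.of S M)).hom,
    Module.injective_module_of_injective_object (inj := CategoryTheory.Injective.injective_under _),
    (ModuleCat.mono_iff_injective _).1 inferInstance⟩

theorem AbsPureLeft.mem_sol (hM : AbsPureLeft R M) {x : Fin n → M}
    (hx : ∀ w ∈ φ.dual.sol R, ∑ i, w i • x i = 0) : x ∈ φ.sol M := by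
  obtain ⟨E, _, _, f, hE, hf⟩ := exists_embedding_injective R M
  refine (hM E f hf).2 n φ x (LeftPP.mem_sol_of_injective fun w hw => ?_)
  simp only [← map_smul, ← map_sum, hx w hw, map_zero]

theorem AbsPureRight.mem_sol (hA : AbsPureRight R A) {w : Fin n → A}
    (hw : ∀ x ∈ ψ.dual.sol R, ∑ i, op (x i) • w i = 0) : w ∈ ψ.sol A := by
  obtain ⟨E, _, _, f, hE, hf⟩ := exists_embedding_injective Rᵐᵒᵖ A
  refine (hA E f hf).2 n ψ w (RightPP.mem_sol_of_injective fun x hx => ?_)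
  simp only [← map_smul, ← map_sum, hw x hx, map_zero]

theorem LeftPP.map_mem_sol (f : M →ₗ[R] M') {x : Fin n → M} (hx : x ∈ φ.sol M) :
    (fun i => f (x i)) ∈ φ.sol M' := by
  obtain ⟨y, hy⟩ := hx
  exact ⟨f ∘ y, fun i => by
    simpa only [map_sum, map_smul, Function.comp_apply] using congrArg f (hy i)⟩

theorem absPureLeft_of_injective [Module.Injective R M] : AbsPureLeft R M := by
  refine fun N _ _ f hf => ⟨hf, fun n φ x hx => ?_⟩
  obtain ⟨g, hg⟩ := Module.Injective.out f hf (LinearMap.id : M →ₗ[R] M)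
  simpa only [hg, LinearMap.id_apply] using LeftPP.map_mem_sol g hx

/-! ### The pp criterion for flatness -/

/-- The subgroup `φ(R) M` of `Mⁿ`, where a column `s : Rⁿ` multiplies `z : M` to `(sᵢ z)ᵢ`. -/
def LeftPP.solSMul (φ : LeftPP R n) (M : Type u) [AddCommGroup M] [Module R M] :
    AddSubgroup (Fin n → M) :=
  .closure {x | ∃ s ∈ φ.sol R, ∃ z : M, x = fun i => s i • z}

/-- The solution set of a left pp formula as a subgroup of `Mⁿ`. -/
def LeftPP.solAddSubgroup (φ : LeftPP R n) (M : Type u) [AddCommGroup M] [Module R M] :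
    AddSubgroup (Fin n → M) where
  carrier := φ.sol M
  zero_mem' := ⟨0, fun _ => by simp only [Pi.zero_apply, smul_zero, Finset.sum_const_zero]⟩
  add_mem' := fun ⟨y, hy⟩ ⟨y', hy'⟩ => ⟨y + y', fun i => by
    simp only [Pi.add_apply, smul_add, Finset.sum_add_distrib, hy, hy']⟩
  neg_mem' hx := LeftPP.map_mem_sol (-LinearMap.id) hx

theorem LeftPP.smul_mem_sol {s : Fin n → R} (hs : s ∈ φ.sol R) (z : M) :
    (fun i => s i • z) ∈ φ.sol M :=
  LeftPP.map_mem_sol (.toSpanSingleton R M z) hs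

theorem LeftPP.solSMul_subset_sol : (φ.solSMul M : Set (Fin n → M)) ⊆ φ.sol M := by
  refine (AddSubgroup.closure_le (φ.solAddSubgroup M)).2 ?_
  rintro _ ⟨s, hs, z, rfl⟩
  exact smul_mem_sol hs z

theorem FlatLeft.sol_subset_solSMul (hM : FlatLeft R M) : φ.sol M ⊆ φ.solSMul M := by
  have := flatLeft_iff_injective_characterModule.1 hM
  intro x hx
  by_contra hxM
  obtain ⟨χ, hχ, hχx⟩ := exists_characters_separating hxM
  refine hχx (LeftPP.mem_sol_iff_characters.1 hx χ (RightPP.mem_sol_of_injective fun s hs => ?_))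
  rw [LeftPP.dual_dual_sol] at hs
  refine CharacterModule.ext _ fun z => ?_
  rw [sum_characterModule_apply]
  exact hχ _ (AddSubgroup.subset_closure ⟨s, hs, z, rfl⟩)

theorem LeftPP.exists_finite_of_mem_solSMul {x : Fin n → M} (hx : x ∈ φ.solSMul M) :
    ∃ S ⊆ φ.sol R, S.Finite ∧ ∀ w, (∀ s ∈ S, w ⬝ᵥ s = 0) → ∑ i, w i • x i = 0 := by
  induction hx using AddSubgroup.closure_induction with
  | mem x hx =>
    obtain ⟨s, hs, z, rfl⟩ := hx
    refine ⟨{s}, Set.singleton_subset_iff.2 hs, Set.finite_singleton s, fun w hw => ?_⟩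
    rw [← zero_smul R z, ← hw s rfl]
    simp only [dotProduct, Finset.sum_smul, smul_smul]
  | zero =>
    exact ⟨∅, Set.empty_subset _, Set.finite_empty, fun w _ => by
      simp only [Pi.zero_apply, smul_zero, Finset.sum_const_zero]⟩
  | add x y _ _ ihx ihy =>
    obtain ⟨S, hS, hSfin, hSx⟩ := ihx
    obtain ⟨T, hT, hTfin, hTy⟩ := ihy
    refine ⟨S ∪ T, Set.union_subset hS hT, hSfin.union hTfin, fun w hw => ?_⟩
    simp only [Pi.add_apply, smul_add, Finset.sum_add_distrib,
      hSx w fun s hs => hw s (.inl hs), hTy w fun s hs => hw s (.inr hs), add_zero]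
  | neg x _ ihx =>
    obtain ⟨S, hS, hSfin, hSx⟩ := ihx
    refine ⟨S, hS, hSfin, fun w hw => ?_⟩
    simp only [Pi.neg_apply, smul_neg, Finset.sum_neg_distrib, hSx w hw, neg_zero]

/-- The quantifier-free formula `C x = 0`. -/
def LeftPP.linearSystem {m : ℕ} (C : Matrix (Fin m) (Fin n) R) : LeftPP R n :=
  ⟨0, m, 0, C⟩

theorem LeftPP.mem_linearSystem_sol {m : ℕ} {C : Matrix (Fin m) (Fin n) R} {x : Fin n → M} :
    x ∈ (linearSystem C).sol M ↔ ∀ i, ∑ j, C i j • x j = 0 :=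
  ⟨fun ⟨_, hy⟩ i => (hy i).symm, fun h => ⟨0, fun i => (h i).symm⟩⟩

theorem sum_apply_eq_zero_of_mem_solSMul {I : Ideal Rᵐᵒᵖ} (h : I →ₗ[Rᵐᵒᵖ] CharacterModule M)
    {a : Fin n → I} {x : Fin n → M}
    (hx : x ∈ (LeftPP.linearSystem (replicateRow (Fin 1) fun i => unop (a i).1)).solSMul M) :
    ∑ i, h (a i) (x i) = 0 := by
  induction hx using AddSubgroup.closure_induction with
  | mem x hx =>
    obtain ⟨s, hs, z, rfl⟩ := hx
    have hsa : ∑ i, op (s i) • a i = 0 := Subtype.ext <| unop_injective <| by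
      simpa [Finset.unop_sum] using LeftPP.mem_linearSystem_sol.1 hs 0
    calc ∑ i, h (a i) (s i • z) = h (∑ i, op (s i) • a i) z := by
          simp only [map_sum, map_smul, sum_characterModule_apply, op_smul_characterModule_apply]
      _ = 0 := by rw [hsa, map_zero]; rfl
  | zero => simp only [Pi.zero_apply, map_zero, Finset.sum_const_zero]
  | add x y _ _ ihx ihy =>
    simp only [Pi.add_apply, map_add, Finset.sum_add_distrib, ihx, ihy, add_zero]
  | neg x _ ihx => simp only [Pi.neg_apply, map_neg, Finset.sum_neg_distrib, ihx, neg_zero]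

theorem flatLeft_of_sol_subset_solSMul
    (hM : ∀ (n : ℕ) (φ : LeftPP R n), φ.sol M ⊆ φ.solSMul M) : FlatLeft R M := by
  refine flatLeft_iff_injective_characterModule.2 (Module.Baer.injective fun I h => ?_)
  let action : I ⊗[ℤ] M →ₗ[ℤ] M := biadditiveLift
    ((smulAddHom R M).comp (opAddEquiv.symm.toAddMonoidHom.comp I.subtype.toAddMonoidHom))
  let pairing : I ⊗[ℤ] M →ₗ[ℤ] AddCircle (1 : ℚ) := biadditiveLift h.toAddMonoidHom
  have ker_le : LinearMap.ker action ≤ LinearMap.ker pairing := by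
    intro t ht
    obtain ⟨n, a, x, rfl⟩ := TensorProduct.exists_sum_tmul_eq t
    rw [LinearMap.mem_ker, map_sum] at ht ⊢
    exact sum_apply_eq_zero_of_mem_solSMul h
      (hM _ _ (LeftPP.mem_linearSystem_sol.2 fun _ => ht))
  obtain ⟨c, hc⟩ := exists_comp_eq_of_ker_le (Module.Baer.of_divisible _) _ _ ker_le
  exact ⟨.toSpanSingleton Rᵐᵒᵖ (CharacterModule M) c.toAddMonoidHom, fun a ha =>
    CharacterModule.ext _ fun x => congr($hc ((⟨a, ha⟩ : I) ⊗ₜ x))⟩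

/-! ### Free realizations -/

theorem LeftPP.exists_freeRealization (φ : LeftPP R n) :
    ∃ (N : Type u) (_ : AddCommGroup N) (_ : Module R N) (x : Fin n → N),
      Module.FinitePresentation R N ∧ x ∈ φ.sol N ∧
        ∀ w, ∑ i, w i • x i = 0 → w ∈ φ.dual.sol R := by
  let relations := LinearMap.range (φ.A.vecMulLinear.prod (-φ.B.vecMulLinear))
  let fy := relations.mkQ ∘ₗ LinearMap.inl R (Fin φ.k → R) (Fin n → R)
  let fx := relations.mkQ ∘ₗ LinearMap.inr R (Fin φ.k → R) (Fin n → R)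
  refine ⟨_ ⧸ relations, inferInstance, inferInstance, fun i => fx fun j => if i = j then 1 else 0,
    Module.finitePresentation_of_free_of_surjective _ (Submodule.mkQ_surjective relations) ?_,
    ⟨fun i => fy fun j => if i = j then 1 else 0, fun i => ?_⟩, fun w hw => ?_⟩
  · rw [Submodule.ker_mkQ]
    exact Module.Finite.iff_fg.1 inferInstance
  · rw [← LinearMap.pi_apply_eq_sum_univ fy, ← LinearMap.pi_apply_eq_sum_univ fx]
    refine (Submodule.Quotient.eq _).2 ⟨Pi.single i 1, ?_⟩
    refine Prod.ext ?_ ?_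
    · simp [Matrix.row]
    · simp [Matrix.row]
  · rw [← LinearMap.pi_apply_eq_sum_univ fx] at hw
    obtain ⟨z, hz⟩ := (Submodule.Quotient.mk_eq_zero _).1 hw
    obtain ⟨hzA, hzB⟩ := Prod.ext_iff.1 hz
    refine LeftPP.mem_dual_sol.2 ⟨-z, fun j => ?_, fun j => ?_⟩
    · simpa [vecMul, dotProduct] using congrFun hzA j
    · simpa [vecMul, dotProduct] using congrFun hzB j

/-! ### Finite test sets -/

/-- The solutions of the dual of `φ` in `R` are cut out by the equations `w s = 0` for finitely
many solutions `s` of `φ` in `R`. -/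
def LeftPP.HasFiniteTestSet (φ : LeftPP R n) : Prop :=
  ∃ S ⊆ φ.sol R, S.Finite ∧ ∀ w, (∀ s ∈ S, w ⬝ᵥ s = 0) → w ∈ φ.dual.sol R

theorem LeftPP.hasFiniteTestSet_of_flat_embedding
    (h : ∀ (N : Type u) [AddCommGroup N] [Module R N], Module.FinitePresentation R N →
      ∃ (M : Type u) (_ : AddCommGroup M) (_ : Module R M) (f : N →ₗ[R] M),
        FlatLeft R M ∧ Function.Injective f)
    (n : ℕ) (φ : LeftPP R n) : φ.HasFiniteTestSet := by
  obtain ⟨N, _, _, x, hN, hx, hx_generic⟩ := φ.exists_freeRealization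
  obtain ⟨M, _, _, f, hM, hf⟩ := h N hN
  obtain ⟨S, hS, hSfin, hSx⟩ :=
    LeftPP.exists_finite_of_mem_solSMul (hM.sol_subset_solSMul (LeftPP.map_mem_sol f hx))
  refine ⟨S, hS, hSfin, fun w hw => hx_generic w (hf ?_)⟩
  simpa only [map_sum, map_smul, map_zero] using hSx w hw

/-- The formula `∃ x₀ φ(x₀, x)`. -/
def LeftPP.existsFirst (φ : LeftPP R (n + 1)) : LeftPP R n :=
  ⟨φ.k + 1, φ.m, .of fun i => vecCons (-φ.B i 0) (φ.A i), .of fun i => vecTail (φ.B i)⟩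

/-- The unary formula `φ(x₀, 0)`. -/
def LeftPP.restrictFirst (φ : LeftPP R (n + 1)) : LeftPP R 1 :=
  ⟨φ.k, φ.m, φ.A, .of fun i _ => φ.B i 0⟩

theorem LeftPP.mem_existsFirst_sol {φ : LeftPP R (n + 1)} {x : Fin n → M} :
    x ∈ φ.existsFirst.sol M ↔ ∃ x₀, vecCons x₀ x ∈ φ.sol M := by
  change (∃ y : Fin (φ.k + 1) → M, ∀ i, ∑ j, vecCons (-φ.B i 0) (φ.A i) j • y j =
      ∑ j, φ.B i j.succ • x j) ↔
    ∃ (x₀ : M) (y : Fin φ.k → M), ∀ i, ∑ j, φ.A i j • y j = ∑ j, φ.B i j • vecCons x₀ x j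
  simp only [Fin.exists_fin_succ_pi, Fin.sum_univ_succ, cons_val_zero, cons_val_succ,
    Fin.cons_zero, Fin.cons_succ, neg_smul, neg_add_eq_iff_eq_add]

theorem LeftPP.mem_restrictFirst_sol {φ : LeftPP R (n + 1)} {x : Fin 1 → M} :
    x ∈ φ.restrictFirst.sol M ↔ vecCons (x 0) 0 ∈ φ.sol M := by
  change (∃ y : Fin φ.k → M, ∀ i, ∑ j, φ.A i j • y j = ∑ j : Fin 1, φ.B i 0 • x j) ↔
    ∃ y : Fin φ.k → M, ∀ i, ∑ j, φ.A i j • y j = ∑ j, φ.B i j • vecCons (x 0) 0 j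
  simp [Fin.sum_univ_succ]

theorem LeftPP.mem_existsFirst_dual_sol {φ : LeftPP R (n + 1)} {w : Fin n → A} :
    w ∈ φ.existsFirst.dual.sol A ↔ vecCons 0 w ∈ φ.dual.sol A := by
  simp only [LeftPP.mem_dual_sol, existsFirst, of_apply, Fin.forall_fin_succ, cons_val_zero,
    cons_val_succ, vecTail, Function.comp_apply, op_neg, neg_smul, Finset.sum_neg_distrib,
    neg_eq_zero]
  exact exists_congr fun z => by tauto

theorem LeftPP.mem_restrictFirst_dual_sol {φ : LeftPP R (n + 1)} {w : Fin 1 → A} :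
    w ∈ φ.restrictFirst.dual.sol A ↔ ∃ w', vecCons (w 0) w' ∈ φ.dual.sol A := by
  simp only [LeftPP.mem_dual_sol, restrictFirst, of_apply, Fin.forall_fin_succ, cons_val_zero,
    cons_val_succ, IsEmpty.forall_iff, and_true]
  constructor
  · rintro ⟨z, hzA, hzB⟩
    exact ⟨_, z, hzA, hzB, fun _ => rfl⟩
  · rintro ⟨w', z, hzA, hzB, -⟩
    exact ⟨z, hzA, hzB⟩

theorem RightPP.add_mem_sol {w w' : Fin n → A} (hw : w ∈ ψ.sol A) (hw' : w' ∈ ψ.sol A) :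
    w + w' ∈ ψ.sol A := by
  obtain ⟨y, hy⟩ := hw
  obtain ⟨y', hy'⟩ := hw'
  exact ⟨y + y', fun j => by
    simp only [Pi.add_apply, smul_add, Finset.sum_add_distrib, hy, hy']⟩

theorem LeftPP.HasFiniteTestSet.of_existsFirst_of_restrictFirst {φ : LeftPP R (n + 1)}
    (hφ : φ.existsFirst.HasFiniteTestSet) (hφ' : φ.restrictFirst.HasFiniteTestSet) :
    φ.HasFiniteTestSet := by
  obtain ⟨S, hS, hSfin, hStest⟩ := hφ
  obtain ⟨T, hT, hTfin, hTtest⟩ := hφ'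
  choose! x₀ hx₀ using fun s (hs : s ∈ S) => LeftPP.mem_existsFirst_sol.1 (hS hs)
  refine ⟨(fun s => vecCons (x₀ s) s) '' S ∪ (fun t => vecCons (t 0) 0) '' T,
    Set.union_subset (by rintro _ ⟨s, hs, rfl⟩; exact hx₀ s hs)
      (by rintro _ ⟨t, ht, rfl⟩; exact LeftPP.mem_restrictFirst_sol.1 (hT ht)),
    (hSfin.image _).union (hTfin.image _), fun w hw => ?_⟩
  have hwS : ∀ s ∈ S, w ⬝ᵥ vecCons (x₀ s) s = 0 := fun s hs => hw _ (.inl ⟨s, hs, rfl⟩)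
  have hwT : ∀ t ∈ T, w ⬝ᵥ vecCons (t 0) 0 = 0 := fun t ht => hw _ (.inr ⟨t, ht, rfl⟩)
  obtain ⟨v, hv⟩ : ∃ v, vecCons (w 0) v ∈ φ.dual.sol R :=
    LeftPP.mem_restrictFirst_dual_sol.1 (hTtest (fun _ => w 0) fun t ht => by
      simpa [dotProduct, Fin.sum_univ_succ] using hwT t ht)
  have hwv : vecTail w - v ∈ φ.existsFirst.dual.sol R := hStest _ fun s hs => by
    have hvs : vecCons (w 0) v ⬝ᵥ vecCons (x₀ s) s = 0 := LeftPP.sum_smul_eq_zero hv (hx₀ s hs)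
    rw [cons_dotProduct_cons] at hvs
    have hws := hwS s hs
    rw [dotProduct_cons] at hws
    rw [sub_dotProduct, eq_neg_of_add_eq_zero_right hvs, eq_neg_of_add_eq_zero_right hws]
    exact sub_self _
  have hw_eq : w = vecCons (w 0) v + vecCons 0 (vecTail w - v) := by
    rw [cons_add_cons, add_zero, add_sub_cancel]
    exact (cons_head_tail w).symm
  rw [hw_eq]
  exact RightPP.add_mem_sol hv (LeftPP.mem_existsFirst_dual_sol.1 hwv)

theorem LeftPP.hasFiniteTestSet_of_unary (h : ∀ φ : LeftPP R 1, φ.HasFiniteTestSet) :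
    ∀ (n : ℕ) (φ : LeftPP R n), φ.HasFiniteTestSet
  | 0, _ => ⟨∅, Set.empty_subset _, Set.finite_empty, fun _ _ =>
      LeftPP.mem_dual_sol.2 ⟨0, fun _ => by simp, fun j => j.elim0⟩⟩
  | n + 1, _ => .of_existsFirst_of_restrictFirst (hasFiniteTestSet_of_unary h n _) (h _)

/-! ### Divisibility and annihilation formulas -/

variable {k : ℕ} {D : Matrix (Fin n) (Fin k) R}

theorem LeftPP.mem_divisibility_sol {x : Fin n → M} :
    x ∈ (divisibility D).sol M ↔ ∃ y : Fin k → M, ∀ i, ∑ j, D i j • y j = x i := by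
  change (∃ y : Fin k → M, ∀ i, ∑ j, D i j • y j = ∑ j, (1 : Matrix _ _ R) i j • x j) ↔ _
  simp [one_apply]

theorem LeftPP.mem_divisibility_dual_sol {w : Fin n → A} :
    w ∈ (divisibility D).dual.sol A ↔ ∀ j, ∑ i, op (D i j) • w i = 0 := by
  refine LeftPP.mem_dual_sol.trans ?_
  change (∃ z : Fin n → A, (∀ j, ∑ i, op (D i j) • z i = 0) ∧
    ∀ j, ∑ i, op ((1 : Matrix _ _ R) i j) • z i = w j) ↔ _
  simp [one_apply, apply_ite op, ← funext_iff]

theorem RightPP.mem_annihilation_sol {w : Fin n → A} :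
    w ∈ (annihilation D).sol A ↔ ∀ j, ∑ i, op (D i j) • w i = 0 :=
  ⟨fun ⟨_, h⟩ j => (h j).symm, fun h => ⟨0, fun j => (h j).symm⟩⟩

theorem RightPP.annihilation_dual_sol :
    (annihilation D).dual.sol M = (LeftPP.divisibility D).sol M := by
  ext x
  rw [LeftPP.mem_divisibility_sol, RightPP.mem_dual_sol]
  exact ⟨fun ⟨v, _, hv⟩ => ⟨v, hv⟩, fun ⟨v, hv⟩ => ⟨v, fun i => i.elim0, hv⟩⟩

theorem LeftPP.divisibility_sol_subset_solSMul (hD : ∀ j, D.col j ∈ φ.sol R) :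
    (divisibility D).sol M ⊆ φ.solSMul M := by
  intro x hx
  obtain ⟨y, hy⟩ := mem_divisibility_sol.1 hx
  obtain rfl : ∑ j, (fun i => D i j • y j) = x := by
    ext i
    rw [Finset.sum_apply, hy]
  exact sum_mem fun j _ => AddSubgroup.subset_closure ⟨D.col j, hD j, y j, rfl⟩

theorem LeftPP.divisibility_below_iff :
    (divisibility D).Below φ ↔ ∀ j, D.col j ∈ φ.sol R := by
  refine ⟨fun h j => h R (mem_divisibility_sol.2 ⟨Pi.single j 1, fun i => ?_⟩),
    fun h M _ _ => (divisibility_sol_subset_solSMul h).trans solSMul_subset_sol⟩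
  simp [Pi.single_apply]

theorem RightPP.below_annihilation_iff :
    ψ.Below (annihilation D) ↔ ∀ j, D.col j ∈ ψ.dual.sol R := by
  refine ⟨fun h j => LeftPP.mem_sol_iff_characters.2 fun χ hχ => ?_,
    fun h X _ _ w hw => mem_annihilation_sol.2 fun j => sum_op_smul_eq_zero hw (h j)⟩
  rw [RightPP.dual_dual_sol] at hχ
  have : (∑ i, op (D i j) • χ i) (1 : R) = 0 := by
    rw [mem_annihilation_sol.1 (h _ hχ) j]
    rfl
  simpa [sum_characterModule_apply, op_smul_characterModule_apply] using this

/-! ### The pp conditions in terms of test sets -/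

theorem LeftPP.HasFiniteTestSet.exists_matrix (hφ : φ.HasFiniteTestSet) :
    ∃ (k : ℕ) (D : Matrix (Fin n) (Fin k) R), (∀ j, D.col j ∈ φ.sol R) ∧
      ∀ w, w ᵥ* D = 0 → w ∈ φ.dual.sol R := by
  obtain ⟨S, hS, hSfin, hStest⟩ := hφ
  obtain ⟨k, s, -, rfl⟩ := hSfin.fin_param
  exact ⟨k, .of fun i j => s j i, fun j => hS ⟨j, rfl⟩,
    fun w hw => hStest w (Set.forall_mem_range.2 fun j => congrFun hw j)⟩

theorem divisibilityCondition_of_hasFiniteTestSet (h : ∀ φ : LeftPP R n, φ.HasFiniteTestSet) :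
    DivisibilityCondition R n := by
  intro φ
  obtain ⟨k, D, hDφ, hDtest⟩ := (h φ).exists_matrix
  have hD := LeftPP.divisibility_below_iff.2 hDφ
  refine ⟨k, D, hD, fun M _ _ hM => Set.Subset.antisymm (fun x hx => ?_) (hD M)⟩
  refine hM.mem_sol fun w hw => LeftPP.sum_smul_eq_zero (hDtest w ?_) hx
  exact funext (LeftPP.mem_divisibility_dual_sol.1 hw)

theorem DivisibilityCondition.annihilationCondition (h : DivisibilityCondition R n) :
    AnnihilationCondition R n := by
  intro ψ
  obtain ⟨k, D, hDψ, hD⟩ := h ψ.dual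
  refine ⟨k, D, RightPP.below_annihilation_iff.2 (LeftPP.divisibility_below_iff.1 hDψ),
    fun F _ _ hF => Set.ext fun w => ?_⟩
  have := flatRight_iff_injective_characterModule.1 hF
  rw [RightPP.mem_sol_iff_characters, RightPP.mem_sol_iff_characters,
    RightPP.annihilation_dual_sol, hD _ absPureLeft_of_injective]

theorem AnnihilationCondition.hasFiniteTestSet (h : AnnihilationCondition R n)
    (φ : LeftPP R n) : φ.HasFiniteTestSet := by
  obtain ⟨k, D, hDφ, hD⟩ := h φ.dual
  refine ⟨Set.range D.col, Set.range_subset_iff.2 fun j => ?_, Set.finite_range _, fun w hw => ?_⟩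
  · rw [← LeftPP.dual_dual_sol]
    exact RightPP.below_annihilation_iff.1 hDφ j
  · rw [hD R (flatRight_self R)]
    exact RightPP.mem_annihilation_sol.2 fun j => hw _ ⟨j, rfl⟩

/-! ### Consequences of finite test sets -/

theorem flatLeft_of_absPureLeft (h : ∀ (n : ℕ) (φ : LeftPP R n), φ.HasFiniteTestSet)
    (hM : AbsPureLeft R M) : FlatLeft R M := by
  refine flatLeft_of_sol_subset_solSMul fun n φ => ?_
  obtain ⟨k, D, hDφ, hφD⟩ := divisibilityCondition_of_hasFiniteTestSet (h n) φ
  rw [hφD M hM]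
  exact LeftPP.divisibility_sol_subset_solSMul (LeftPP.divisibility_below_iff.1 hDφ)

theorem LeftPP.mem_linearSystem_dual_sol {m : ℕ} {C : Matrix (Fin m) (Fin n) R} {w : Fin n → R} :
    w ∈ (linearSystem C).dual.sol R ↔ ∃ z, z ᵥ* C = w :=
  mem_dual_sol.trans
    ⟨fun ⟨z, _, hz⟩ => ⟨z, funext hz⟩, fun ⟨z, hz⟩ => ⟨z, fun j => j.elim0, congrFun hz⟩⟩

theorem exists_embedding_free_of_hasFiniteTestSet
    (h : ∀ (n : ℕ) (φ : LeftPP R n), φ.HasFiniteTestSet)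
    (P : Type u) [AddCommGroup P] [Module R P] [Module.FinitePresentation R P] :
    ∃ (F : Type u) (_ : AddCommGroup F) (_ : Module R F) (f : P →ₗ[R] F),
      Module.Free R F ∧ Function.Injective f := by
  obtain ⟨n, m, f, g, hf, hfg⟩ := Module.FinitePresentation.exists_fin' R P
  obtain ⟨C, rfl⟩ := Matrix.toLinearMapRight'.surjective g
  obtain ⟨k, D, hDC, hDtest⟩ := (h n (.linearSystem C)).exists_matrix
  have ker_eq : LinearMap.ker f = LinearMap.ker D.vecMulLinear := by
    ext w
    rw [LinearMap.mem_ker, hfg w, LinearMap.mem_ker, vecMulLinear_apply]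
    refine ⟨?_, fun hw => LeftPP.mem_linearSystem_dual_sol.1 (hDtest w hw)⟩
    rintro ⟨z, rfl⟩
    have hCD : C * D = 0 := by
      ext i j
      exact LeftPP.mem_linearSystem_sol.1 (hDC j) i
    rw [toLinearMapRight'_apply, vecMul_vecMul, hCD, vecMul_zero]
  refine ⟨Fin k → R, inferInstance, inferInstance,
    (LinearMap.ker f).liftQ D.vecMulLinear ker_eq.le ∘ₗ
      (f.quotKerEquivOfSurjective hf).symm.toLinearMap, inferInstance, ?_⟩
  have liftQ_injective := LinearMap.ker_eq_bot.1 (Submodule.ker_liftQ_eq_bot' _ _ ker_eq)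
  exact liftQ_injective.comp (LinearEquiv.injective _)

theorem absPureRight_of_hasFiniteTestSet (h : ∀ (n : ℕ) (φ : LeftPP R n), φ.HasFiniteTestSet) :
    AbsPureRight R R := by
  intro N _ _ f hf
  refine ⟨hf, fun n ψ w hw => ?_⟩
  obtain ⟨S, hS, -, hStest⟩ := h n ψ.dual
  rw [← RightPP.dual_dual_sol]
  refine hStest w fun s hs => hf ?_
  simpa [dotProduct, ← map_smul, ← map_sum] using RightPP.sum_op_smul_eq_zero hw (hS hs)

/-- The right ideal `φ(R)` of a unary left pp formula. -/
def LeftPP.rightIdeal (φ : LeftPP R 1) : Submodule Rᵐᵒᵖ R where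
  carrier := {b | (fun _ => b) ∈ φ.sol R}
  zero_mem' := (φ.solAddSubgroup R).zero_mem
  add_mem' := (φ.solAddSubgroup R).add_mem
  smul_mem' r _ hb := smul_mem_sol hb r.unop

theorem rightACoherent_of_hasFiniteTestSet (h : ∀ φ : LeftPP R 1, φ.HasFiniteTestSet) :
    RightACoherent R := by
  intro φ
  obtain ⟨S, hS, hSfin, hStest⟩ := h φ
  let I₀ : Submodule Rᵐᵒᵖ R := .span Rᵐᵒᵖ ((fun s => s 0) '' S)
  have hI₀ : I₀ ≤ φ.rightIdeal := by
    refine Submodule.span_le.2 ?_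
    rintro _ ⟨s, hs, rfl⟩
    have hsφ := hS hs
    rwa [eq_const_of_unique s] at hsφ
  refine ⟨I₀, Submodule.fg_span (hSfin.image _), hI₀,
    Set.Subset.antisymm (fun a ha b hb => ha b (hI₀ hb)) fun a ha b hb => ?_⟩
  have ha_dual : (fun _ => a) ∈ φ.dual.sol R := hStest _ fun s hs => by
    simpa [dotProduct] using ha _ (Submodule.subset_span ⟨s, hs, rfl⟩)
  simpa using LeftPP.sum_smul_eq_zero ha_dual hb

theorem hasFiniteTestSet_of_rightACoherent (hR : AbsPureRight R R) (hR' : RightACoherent R)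
    (φ : LeftPP R 1) : φ.HasFiniteTestSet := by
  obtain ⟨I₀, hI₀fin, hI₀φ, hI₀⟩ := hR' φ
  obtain ⟨T, hTfin, rfl⟩ := Submodule.fg_def.1 hI₀fin
  refine ⟨(fun b _ => b) '' T, ?_, hTfin.image _, fun w hw => hR.mem_sol fun s hs => ?_⟩
  · rintro _ ⟨b, hb, rfl⟩
    exact hI₀φ b (Submodule.subset_span hb)
  · have hwT : .span Rᵐᵒᵖ T ≤ LinearMap.ker (DistribSMul.toLinearMap Rᵐᵒᵖ R (w 0)) :=
      Submodule.span_le.2 fun b hb => by simpa [dotProduct] using hw _ ⟨b, hb, rfl⟩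
    have hwφ := hI₀.ge hwT (s 0)
    rw [LeftPP.dual_dual_sol, eq_const_of_unique s] at hs
    simpa using hwφ hs

/-! ### Injective envelopes -/

section Essential

variable {α : Type*}

/-- `b` is an essential extension of `a`: it lies above `a` and every nonzero element below `b`
meets `a`. -/
def IsEssentialExtension [PartialOrder α] [OrderBot α] (a b : α) : Prop :=
  a ≤ b ∧ ∀ c ≤ b, Disjoint c a → c = ⊥

theorem IsEssentialExtension.trans [SemilatticeInf α] [OrderBot α] {a b c : α}
    (hab : IsEssentialExtension a b) (hbc : IsEssentialExtension b c) :
    IsEssentialExtension a c :=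
  ⟨hab.1.trans hbc.1, fun d hdc hda => hbc.2 d hdc <|
    disjoint_iff.2 (hab.2 _ inf_le_right (hda.mono_left inf_le_left))⟩

variable [CompleteLattice α] [IsCompactlyGenerated α]

theorem exists_maximal_disjoint (a : α) : ∃ b, Maximal (Disjoint a) b :=
  (zorn_le_nonempty₀ {b | Disjoint a b} (fun c hc hchain _ _ =>
    ⟨sSup c, hchain.directedOn.disjoint_sSup_right.2 hc, fun _ => le_sSup⟩)
    ⊥ disjoint_bot_right).imp fun _ hb => hb.2

theorem exists_maximal_isEssentialExtension (a : α) :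
    ∃ b, Maximal (IsEssentialExtension a) b := by
  refine (zorn_le_nonempty₀ {b | IsEssentialExtension a b} (fun c hc hchain b hb => ?_)
    a ⟨le_rfl, fun d hd hda => hda.eq_bot_of_le hd⟩).imp fun _ hb => hb.2
  refine ⟨sSup c, ⟨(hc hb).1.trans (le_sSup hb), fun d hd hda => ?_⟩, fun _ => le_sSup⟩
  have hd_disjoint : Disjoint d (sSup c) := hchain.directedOn.disjoint_sSup_right.2 fun e he =>
    disjoint_iff.2 ((hc he).2 _ inf_le_right (hda.mono_left inf_le_left))
  exact hd_disjoint.eq_bot_of_le hd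

end Essential

theorem isEssentialExtension_range {N K : Submodule R M} (hK : Maximal (Disjoint N) K)
    {p : M →ₗ[R] M} (hpN : ∀ x ∈ N, p x = x) (hpK : K ≤ LinearMap.ker p) :
    IsEssentialExtension N (LinearMap.range p) := by
  refine ⟨fun x hx => ⟨x, hpN x hx⟩, fun L hL hLN => ?_⟩
  have comap_le : L.comap p ≤ K := by
    refine hK.le_of_ge (Submodule.disjoint_def.2 fun x hx hxL => ?_) fun x hx => ?_
    · rw [Submodule.mem_comap, hpN x hx] at hxL
      exact Submodule.disjoint_def.1 hLN x hxL hx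
    · rw [Submodule.mem_comap, hpK hx]
      exact L.zero_mem
  refine (Submodule.eq_bot_iff L).2 fun y hy => ?_
  obtain ⟨x, rfl⟩ := hL hy
  exact hpK (comap_le hy)

theorem exists_isProj_of_maximal_isEssentialExtension [Module.Injective R M]
    {S N : Submodule R M} (hN : Maximal (IsEssentialExtension S) N) :
    ∃ p : M →ₗ[R] M, LinearMap.IsProj N p := by
  obtain ⟨K, hK⟩ := exists_maximal_disjoint N
  have mkQ_injective : Function.Injective (K.mkQ ∘ₗ N.subtype) := by
    rw [← LinearMap.ker_eq_bot, LinearMap.ker_comp, Submodule.ker_mkQ,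
      ← Submodule.disjoint_iff_comap_eq_bot]
    exact hK.prop
  obtain ⟨h, hh⟩ := Module.Injective.out _ mkQ_injective N.subtype
  have hN_fixed (x : M) (hx : x ∈ N) : (h ∘ₗ K.mkQ) x = x := hh ⟨x, hx⟩
  have hK_ker : K ≤ LinearMap.ker (h ∘ₗ K.mkQ) :=
    K.ker_mkQ.ge.trans (LinearMap.ker_le_ker_comp K.mkQ h)
  have range_le := hN.le_of_ge
    (hN.prop.trans (isEssentialExtension_range hK hN_fixed hK_ker)) fun x hx => ⟨x, hN_fixed x hx⟩
  exact ⟨h ∘ₗ K.mkQ, fun x => range_le ⟨x, rfl⟩, hN_fixed⟩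

theorem injective_of_isProj [Module.Injective R M] {N : Submodule R M} {p : M →ₗ[R] M}
    (hp : LinearMap.IsProj N p) : Module.Injective R N where
  out X Y _ _ _ _ i hi g := by
    obtain ⟨h, hh⟩ := Module.Injective.out i hi (N.subtype ∘ₗ g)
    refine ⟨hp.codRestrict ∘ₗ h, fun x => ?_⟩
    rw [LinearMap.comp_apply, hh]
    exact hp.codRestrict_apply_cod (g x)

theorem exists_isInjectiveEnvelope (R M : Type u) [Ring R] [AddCommGroup M] [Module R M] :
    ∃ (E : Type u) (_ : AddCommGroup E) (_ : Module R E) (f : M →ₗ[R] E),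
      IsInjectiveEnvelope f := by
  obtain ⟨E, _, _, f, _, hf⟩ := exists_embedding_injective R M
  obtain ⟨N, hN⟩ := exists_maximal_isEssentialExtension (LinearMap.range f)
  obtain ⟨p, hp⟩ := exists_isProj_of_maximal_isEssentialExtension hN
  have hfN (x : M) : f x ∈ N := hN.prop.1 ⟨x, rfl⟩
  refine ⟨N, inferInstance, inferInstance, f.codRestrict N hfN, injective_of_isProj hp,
    fun x y hxy => hf congr(($hxy : E)), fun L hL => ?_⟩
  refine Submodule.map_injective_of_injective N.injective_subtype <| .trans
    (hN.prop.2 _ (Submodule.map_subtype_le N L) (disjoint_iff.2 ?_)) (Submodule.map_bot _).symm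
  rw [Submodule.map_inf_eq_map_inf_comap, ← LinearMap.range_codRestrict N f hfN, hL,
    Submodule.map_bot]

end IFRing

open IFRing in
theorem mainTheorem4 (R : Type u) [Ring R] :
    List.TFAE [
      -- every injective left module is flat
      ∀ (E : Type u) [AddCommGroup E] [Module R E], Module.Injective R E → FlatLeft R E,
      -- the injective envelope of every finitely presented left module is flat
      ∀ (P E : Type u) [AddCommGroup P] [Module R P] [AddCommGroup E] [Module R E]
        (f : P →ₗ[R] E), Module.FinitePresentation R P → IsInjectiveEnvelope f → FlatLeft R E,
      -- every finitely presented left module embeds into a free left module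
      ∀ (P : Type u) [AddCommGroup P] [Module R P], Module.FinitePresentation R P →
        ∃ (F : Type u) (_ : AddCommGroup F) (_ : Module R F) (f : P →ₗ[R] F),
          Module.Free R F ∧ Function.Injective f,
      -- the character module of every free right module is a flat left module
      ∀ (F : Type u) [AddCommGroup F] [Module Rᵐᵒᵖ F], Module.Free Rᵐᵒᵖ F →
        FlatLeft R (CharacterModule F),
      -- the pp condition on absolutely pure left modules, for all formulas and for unary ones
      ∀ n : ℕ, 0 < n → DivisibilityCondition R n,
      DivisibilityCondition R 1,
      -- the pp condition on flat right modules, for all formulas and for unary ones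
      ∀ n : ℕ, 0 < n → AnnihilationCondition R n,
      AnnihilationCondition R 1,
      -- `R` is right absolutely pure and right a-coherent
      AbsPureRight R R ∧ RightACoherent R] := by
  tfae_have 1 → 2 := fun h _ E _ _ _ _ _ _ hf => h E hf.injective_target
  tfae_have 2 → 3 := fun h => exists_embedding_free_of_hasFiniteTestSet <|
    LeftPP.hasFiniteTestSet_of_flat_embedding fun N _ _ hN =>
      have ⟨E, _, _, f, hf⟩ := exists_isInjectiveEnvelope R N
      ⟨E, _, _, f, h N E f hN hf, hf.injective_map⟩
  tfae_have 1 → 4 := fun h F _ _ _ => h _ (injective_characterModule_of_right F)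
  tfae_have 4 → 3 := fun h => exists_embedding_free_of_hasFiniteTestSet <|
    LeftPP.hasFiniteTestSet_of_flat_embedding fun N _ _ _ =>
      have ⟨F, _, _, hF, f, hf⟩ := exists_embedding_characterModule_of_free R N
      ⟨_, _, _, f, h F hF, hf⟩
  tfae_have 3 → 5 := fun h n _ => divisibilityCondition_of_hasFiniteTestSet <|
    LeftPP.hasFiniteTestSet_of_flat_embedding (fun N _ _ hN =>
      have ⟨F, _, _, f, _, hf⟩ := h N hN
      ⟨F, _, _, f, flatLeft_of_projective, hf⟩) n
  tfae_have 5 → 6 := fun h => h 1 one_pos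
  tfae_have 6 → 8 := fun h => h.annihilationCondition
  tfae_have 5 → 7 := fun h n hn => (h n hn).annihilationCondition
  tfae_have 7 → 8 := fun h => h 1 one_pos
  tfae_have 8 → 1 := fun h E _ _ _ => flatLeft_of_absPureLeft
    (LeftPP.hasFiniteTestSet_of_unary h.hasFiniteTestSet) absPureLeft_of_injective
  tfae_have 8 → 9 := fun h =>
    ⟨absPureRight_of_hasFiniteTestSet (LeftPP.hasFiniteTestSet_of_unary h.hasFiniteTestSet),
      rightACoherent_of_hasFiniteTestSet h.hasFiniteTestSet⟩
  tfae_have 9 → 8 := fun ⟨hR, hR'⟩ =>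
    (divisibilityCondition_of_hasFiniteTestSet
      (hasFiniteTestSet_of_rightACoherent hR hR')).annihilationCondition
  tfae_finish
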